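/- Let $d\ge 1$ be a fixed dimension. For a finite set $A\subset\mathbb R^d$ let $\omega(A,u)=\max_{a\in A}\langle u,a\rangle+\max_{a\in A}\langle -u,a\rangle$ be its directional width in direction $u\in\mathbb R^d$, with $\omega(\emptyset,u)=0$. In the existential model, $\mathcal P$ is a finite family of points of $\mathbb R^d$ (locations may repeat); each point $v$ is present independently with probability $p_v$, and $P\sim\mathcal P$ denotes the random set of points present. A family $\mathcal S$ of stochastic points is an $(\varepsilon,\tau)$-quant-kernel of $\mathcal P$ if for all $u\in\mathbb R^d$ and all $x\ge 0$ $$\Pr_{P\sim\mathcal P}[\omega(P,u)\le(1-\varepsilon)x]-\tau\ \le\ \Pr_{S\sim\mathcal S}[\omega(S,u)\le x]\ \le\ \Pr_{P\sim\mathcal P}[\omega(P,u)\le(1+\varepsilon)x]+\tau .$$ It satisfies the subset constraint if it is a subfamily of $\mathcal P$ in which each point keeps its location and its probability and the points are independent. A $\delta$-kernel of a finite family $A$ of (deterministic) points is a subfamily $Q\subseteq A$, nonempty if $A$ is nonempty, with $(1-\delta)\,\omega(A,u)\le\omega(Q,u)\le\omega(A,u)$ for all $u$. **Theorem.** For every $d\ge1$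 there are constants $\alpha\in(0,1]$ and $C_0>0$ depending only on $d$, and for every $\beta\in(0,1]$ there are constants $K,C>0$ depending only on $d$ and $\beta$, such that the following holds for every finite family $\mathcal P$ in the existential model with $p_v\ge\beta$ for all $v$ (the $\beta$-assumption), and all $\varepsilon,\tau>0$ for which $\mu:=\min\{\varepsilon,\tau\}\le 1/2$. Put $\delta=\mu\alpha\beta^2/(4d)$ and $L=\lceil K\log(1/\mu)\rceil$, and consider the following peeling construction with $L$ rounds: in round $i$ choose a $\delta$-kernel $\mathcal S_i$, with at most $C_0\,\delta^{-(d-1)/2}$ points, of the points that remain (treated as deterministic points), and delete the points of $\mathcal S_i$. Then this construction can be carried out, and for every choice of the kernels $\mathcal S_i$ the union $\mathcal S=\bigcup_i\mathcal S_i$, with the probabilities inherited from $\mathcal P$, satisfies $$|\mathcal S|\ \le\ C\,\mu^{-(d-1)/2}\log\frac1\mu$$ and is an $(\varepsilon,\tau)$-quant-kernel of $\mathcal P$. In particular, under the $\beta$-assumption there is an $(\varepsilon,\tau)$-quant-kernel of size $O(\mu^{-(d-1)/2}\log(1/\mu))$ satisfying the subset constraint. -/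

import Mathlib

open scoped BigOperators

noncomputable section

namespace StochKernel

/-- The support function `f(A, u) = max_{a ∈ A} ⟪u, a⟫` of a (finite) point set `A ⊆ ℝ^d`.
For the empty set the value is `0`. -/
def supportFun {d : ℕ} (A : Set (EuclideanSpace ℝ (Fin d))) (u : EuclideanSpace ℝ (Fin d)) : ℝ :=
  sSup ((fun a => inner ℝ u a) '' A)

/-- The directional width `ω(A, u) = f(A, u) + f(A, -u)`.
For the empty set the width is `0`. -/
def dirWidth {d : ℕ} (A : Set (EuclideanSpace ℝ (Fin d))) (u : EuclideanSpace ℝ (Fin d)) : ℝ :=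
  supportFun A u + supportFun A (-u)

/-- A family of stochastic points of `ℝ^d` in the existential uncertainty model: the point with
index `i` sits at `loc i` and is present, independently of the others, with probability `prob i`.
Different indices may share a location. -/
structure ExistentialModel (d : ℕ) (ι : Type*) where
  loc : ι → EuclideanSpace ℝ (Fin d)
  prob : ι → ℝ
  prob_nonneg : ∀ i, 0 ≤ prob i
  prob_le_one : ∀ i, prob i ≤ 1

namespace ExistentialModel

variable {d : ℕ} {ι : Type*}

open Classical in
/-- The probability that exactly the points with indices in `R` are present. -/
def weight [Fintype ι] (P : ExistentialModel d ι) (R : Finset ι) : ℝ :=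
  ∏ i : ι, if i ∈ R then P.prob i else 1 - P.prob i

open Classical in
/-- The probability of an event that depends on the set of present indices. -/
def pr [Fintype ι] (P : ExistentialModel d ι) (E : Finset ι → Prop) : ℝ :=
  ∑ R : Finset ι, if E R then P.weight R else 0

/-- The distribution function `Pr[ω(R, u) ≤ t]` of the directional width of a random
realization. -/
def widthCDF [Fintype ι] (P : ExistentialModel d ι) (u : EuclideanSpace ℝ (Fin d)) (t : ℝ) : ℝ :=
  P.pr (fun R => dirWidth (P.loc '' (R : Set ι)) u ≤ t)

/-- The sub-family with index set `S`; every chosen point keeps its location and its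
probability. -/
def restrict (P : ExistentialModel d ι) (S : Finset ι) :
    ExistentialModel d {i : ι // i ∈ S} where
  loc i := P.loc i
  prob i := P.prob i
  prob_nonneg i := P.prob_nonneg i
  prob_le_one i := P.prob_le_one i

end ExistentialModel

/-- `S` is an `(ε, τ)`-quant-kernel of `P`. -/
def IsQuantKernel {d : ℕ} {ι κ : Type*} [Fintype ι] [Fintype κ] (ε τ : ℝ)
    (S : ExistentialModel d κ) (P : ExistentialModel d ι) : Prop :=
  ∀ (u : EuclideanSpace ℝ (Fin d)) (x : ℝ), 0 ≤ x →
    P.widthCDF u ((1 - ε) * x) - τ ≤ S.widthCDF u x ∧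
      S.widthCDF u x ≤ P.widthCDF u ((1 + ε) * x) + τ

/-- `Q` indexes a (deterministic) `δ`-kernel of the points `loc i`, `i ∈ P`. The width of the empty
set being a convention, a kernel of a nonempty family is required to be nonempty. -/
def IsKernel {d : ℕ} {ι : Type*} (loc : ι → EuclideanSpace ℝ (Fin d)) (δ : ℝ)
    (P Q : Finset ι) : Prop :=
  Q ⊆ P ∧ (P.Nonempty → Q.Nonempty) ∧
    ∀ u : EuclideanSpace ℝ (Fin d),
      (1 - δ) * dirWidth (loc '' (P : Set ι)) u ≤ dirWidth (loc '' (Q : Set ι)) u ∧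
        dirWidth (loc '' (Q : Set ι)) u ≤ dirWidth (loc '' (P : Set ι)) u

open Classical in
/-- The union of the first `k` layers of a sequence `S 0, S 1, …`. -/
def layers {ι : Type*} (S : ℕ → Finset ι) (k : ℕ) : Finset ι :=
  (Finset.range k).biUnion S

open Classical in
/-- `S 0, …, S (L - 1)` is a run of the peeling procedure with `L` rounds: in every round a
deterministic `δ`-kernel, consisting of at most `M` points, of the points that still remain is
taken and then deleted. -/
def IsPeelingRun {d : ℕ} {ι : Type*} [Fintype ι] (loc : ι → EuclideanSpace ℝ (Fin d))
    (δ M : ℝ) (L : ℕ) (S : ℕ → Finset ι) : Prop :=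
  ∀ k < L, IsKernel loc δ (Finset.univ \ layers S k) (S k) ∧ ((S k).card : ℝ) ≤ M

end StochKernel

end

/-! Realize both families on one probability space: a realization of `S` is `R ∩ S` for a
realization `R` of `P`. Then `R ∩ S` is never wider than `R`, which gives the lower bound without
any loss of `τ`.

For the upper bound fix `u`. Each layer contains a pair of points nearly extreme in direction `u`
among the points remaining in its round (`IsKernel.exists_pair`). If such a pair is present, all
points of `R` outside `S` still remained in that round, so they widen `R ∩ S` by at most a factor `1
+ μ` (`dirWidth_le_of_pair_mem`). The layers are disjoint, so the pairs are independent; each is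
present with probability at least `β ^ 2`, and all `L` fail with probability at most `(1 - β ^ 2) ^
L ≤ μ` (`subsetExp_no_pair_le`).

Kernels of the required size (`exists_isKernel`) come from coordinates in which the points lie in a
cube and coordinate functionals are controlled by the width; the points nearest to a grid on the
boundary of a larger cube form the kernel. The error is quadratic in the mesh, whence the exponent
`(d - 1) / 2`. -/

noncomputable section

namespace StochKernel

/-! ### Directional width of finite sets. -/

section Width

variable {d : ℕ} {A B : Set (EuclideanSpace ℝ (Fin d))} {u : EuclideanSpace ℝ (Fin d)}

lemma inner_le_supportFun (hA : A.Finite) {a : EuclideanSpace ℝ (Fin d)} (ha : a ∈ A) :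
    inner ℝ u a ≤ supportFun A u :=
  le_csSup (hA.image _).bddAbove ⟨a, ha, rfl⟩

lemma exists_inner_eq_supportFun (hA : A.Finite) (hne : A.Nonempty) :
    ∃ a ∈ A, inner ℝ u a = supportFun A u := by
  obtain ⟨a, ha, h⟩ := (hne.image (fun a => inner ℝ u a)).csSup_mem (hA.image _)
  exact ⟨a, ha, h⟩

lemma exists_dirWidth_eq (hA : A.Finite) (hne : A.Nonempty) :
    ∃ a ∈ A, ∃ b ∈ A, dirWidth A u = inner ℝ u a - inner ℝ u b ∧
      ∀ p ∈ A, inner ℝ u b ≤ inner ℝ u p ∧ inner ℝ u p ≤ inner ℝ u a := by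
  obtain ⟨a, ha, h⟩ := exists_inner_eq_supportFun (u := u) hA hne
  obtain ⟨b, hb, h'⟩ := exists_inner_eq_supportFun (u := -u) hA hne
  refine ⟨a, ha, b, hb, ?_, fun p hp => ⟨?_, ?_⟩⟩
  · rw [dirWidth, ← h, ← h', inner_neg_left]; ring
  · have := inner_le_supportFun (u := -u) hA hp
    rw [← h', inner_neg_left, inner_neg_left] at this
    linarith
  · exact (inner_le_supportFun hA hp).trans h.ge

lemma inner_sub_inner_le_dirWidth (hA : A.Finite) {a b : EuclideanSpace ℝ (Fin d)}
    (ha : a ∈ A) (hb : b ∈ A) : inner ℝ u a - inner ℝ u b ≤ dirWidth A u := by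
  have h₁ := inner_le_supportFun (u := u) hA ha
  have h₂ := inner_le_supportFun (u := -u) hA hb
  rw [inner_neg_left] at h₂
  rw [dirWidth]; linarith

@[simp] lemma dirWidth_empty : dirWidth (∅ : Set (EuclideanSpace ℝ (Fin d))) u = 0 := by
  simp [dirWidth, supportFun]

lemma dirWidth_nonneg (hA : A.Finite) : 0 ≤ dirWidth A u := by
  rcases A.eq_empty_or_nonempty with rfl | ⟨a, ha⟩
  · simp
  · simpa using inner_sub_inner_le_dirWidth (u := u) hA ha ha

lemma dirWidth_mono (hB : B.Finite) (h : A ⊆ B) : dirWidth A u ≤ dirWidth B u := by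
  rcases A.eq_empty_or_nonempty with rfl | hne
  · simpa using dirWidth_nonneg hB
  · obtain ⟨a, ha, b, hb, hw, -⟩ := exists_dirWidth_eq (u := u) (hB.subset h) hne
    rw [hw]
    exact inner_sub_inner_le_dirWidth hB (h ha) (h hb)

end Width

/-! ### Extreme pairs of a deterministic kernel. -/

section KernelExtremes

variable {d : ℕ} {ι : Type*} {loc : ι → EuclideanSpace ℝ (Fin d)}

/-- The extremes of `Q` already span `(1 - δ)` of the width of `P`, so only `δ` of it is left for
points of `P` beyond either end. -/
lemma IsKernel.exists_pair {δ : ℝ} {P Q : Finset ι} (h : IsKernel loc δ P Q) (hP : P.Nonempty)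
    (u : EuclideanSpace ℝ (Fin d)) :
    ∃ a ∈ Q, ∃ b ∈ Q,
      (1 - δ) * dirWidth (loc '' (P : Set ι)) u ≤ inner ℝ u (loc a) - inner ℝ u (loc b) ∧
      ∀ p ∈ P, inner ℝ u (loc p) ≤ inner ℝ u (loc a) + δ * dirWidth (loc '' (P : Set ι)) u ∧
        inner ℝ u (loc b) - δ * dirWidth (loc '' (P : Set ι)) u ≤ inner ℝ u (loc p) := by
  obtain ⟨hsub, hne, hw⟩ := h
  have hfin : (loc '' (P : Set ι)).Finite := P.finite_toSet.image _
  obtain ⟨_, ⟨a, ha, rfl⟩, _, ⟨b, hb, rfl⟩, hab, -⟩ :=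
    exists_dirWidth_eq (u := u) (Q.finite_toSet.image loc) ((Finset.coe_nonempty.2 (hne hP)).image _)
  have hk := (hw u).1
  rw [hab] at hk
  refine ⟨a, ha, b, hb, hk, fun p hp => ?_⟩
  have h₁ := inner_sub_inner_le_dirWidth (u := u) hfin ⟨p, hp, rfl⟩ ⟨b, hsub hb, rfl⟩
  have h₂ := inner_sub_inner_le_dirWidth (u := u) hfin ⟨a, hsub ha, rfl⟩ ⟨p, hp, rfl⟩
  constructor <;> linarith

/-- If both extremes of a kernel of `P` are present in `A ⊆ B`, and `B` has no points outside
`A ∪ P`, then `B` is hardly wider than `A`. -/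
lemma dirWidth_le_of_pair_mem {A B P : Finset ι} {u : EuclideanSpace ℝ (Fin d)} {δ μ : ℝ}
    (hδ : 0 ≤ δ) (hδμ : 4 * δ ≤ μ) (hμ : μ ≤ 1 / 2) (hBA : ∀ p ∈ B, p ∈ A ∨ p ∈ P)
    {a b : ι} (ha : a ∈ A) (hb : b ∈ A)
    (hw : (1 - δ) * dirWidth (loc '' (P : Set ι)) u ≤ inner ℝ u (loc a) - inner ℝ u (loc b))
    (hp : ∀ p ∈ P, inner ℝ u (loc p) ≤ inner ℝ u (loc a) + δ * dirWidth (loc '' (P : Set ι)) u ∧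
        inner ℝ u (loc b) - δ * dirWidth (loc '' (P : Set ι)) u ≤ inner ℝ u (loc p)) :
    dirWidth (loc '' (B : Set ι)) u ≤ (1 + μ) * dirWidth (loc '' (A : Set ι)) u := by
  have hfA : (loc '' (A : Set ι)).Finite := A.finite_toSet.image _
  set W := dirWidth (loc '' (P : Set ι)) u with hW
  set D := dirWidth (loc '' (A : Set ι)) u with hD
  have hW0 : 0 ≤ W := dirWidth_nonneg (P.finite_toSet.image _)
  have hD0 : 0 ≤ D := dirWidth_nonneg hfA
  have hWD : (1 - δ) * W ≤ D :=
    hw.trans (inner_sub_inner_le_dirWidth hfA ⟨a, ha, rfl⟩ ⟨b, hb, rfl⟩)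
  -- The overshoot `δ * W` can occur at both ends; it is measured against `D ≥ (1 - δ) * W`.
  have hsmall : 2 * δ * W ≤ μ * D := by
    have h₁ : μ * ((1 - δ) * W) ≤ μ * D := mul_le_mul_of_nonneg_left hWD (by linarith)
    have h₂ : 2 * δ ≤ μ * (1 - δ) := by nlinarith
    nlinarith
  obtain ⟨_, ⟨r, hr, rfl⟩, _, ⟨l, hl, rfl⟩, hAeq, hAall⟩ := exists_dirWidth_eq (u := u) hfA
    ⟨_, a, ha, rfl⟩
  have hra := (hAall _ ⟨a, ha, rfl⟩).2
  have hlb := (hAall _ ⟨b, hb, rfl⟩).1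
  have key : ∀ p ∈ B, inner ℝ u (loc p) ≤ inner ℝ u (loc r) + δ * W ∧
      inner ℝ u (loc l) - δ * W ≤ inner ℝ u (loc p) := by
    intro p hpB
    have : 0 ≤ δ * W := mul_nonneg hδ hW0
    rcases hBA p hpB with h | h
    · have := hAall _ ⟨p, h, rfl⟩
      constructor <;> linarith
    · have := hp p h
      constructor <;> linarith
  rcases B.eq_empty_or_nonempty with rfl | hne
  · simp only [Finset.coe_empty, Set.image_empty, dirWidth_empty]
    exact mul_nonneg (by linarith) hD0
  · obtain ⟨_, ⟨x, hx, rfl⟩, _, ⟨y, hy, rfl⟩, hBeq, -⟩ :=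
      exists_dirWidth_eq (u := u) (B.finite_toSet.image loc)
        ((Finset.coe_nonempty.2 hne).image _)
    rw [hBeq]
    have h₁ := (key x hx).1
    have h₂ := (key y hy).2
    linarith

end KernelExtremes

/-! ### Expectations over independent random subsets. -/

section PartialExp

variable {ι : Type*}

open Classical in
/-- The expectation of `F` over random subsets of `A` that contain each `i ∈ A` independently with
probability `p i`. -/
def subsetExp (p : ι → ℝ) (A : Finset ι) (F : Finset ι → ℝ) : ℝ :=
  ∑ R ∈ A.powerset, (∏ i ∈ A, if i ∈ R then p i else 1 - p i) * F R

variable {p : ι → ℝ}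

@[simp] lemma subsetExp_empty (F : Finset ι → ℝ) : subsetExp p ∅ F = F ∅ := by
  simp [subsetExp]

open Classical in
lemma subsetExp_insert {a : ι} {A : Finset ι} (ha : a ∉ A) (F : Finset ι → ℝ) :
    subsetExp p (insert a A) F =
      p a * subsetExp p A (fun R => F (insert a R)) + (1 - p a) * subsetExp p A F := by
  unfold subsetExp
  rw [Finset.sum_powerset_insert ha, Finset.mul_sum, Finset.mul_sum, add_comm]
  congr 1
  · refine Finset.sum_congr rfl fun R hR => ?_
    rw [Finset.prod_insert ha, if_pos (Finset.mem_insert_self a R), ← mul_assoc]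
    congr 2
    refine Finset.prod_congr rfl fun i hi => ?_
    have : i ≠ a := fun h => ha (h ▸ hi)
    simp [Finset.mem_insert, this]
  · refine Finset.sum_congr rfl fun R hR => ?_
    have : a ∉ R := fun h => ha (Finset.mem_powerset.1 hR h)
    rw [Finset.prod_insert ha, if_neg this, ← mul_assoc]

lemma subsetExp_mono (h0 : ∀ i, 0 ≤ p i) (h1 : ∀ i, p i ≤ 1) {A : Finset ι}
    {F G : Finset ι → ℝ} (h : ∀ R ⊆ A, F R ≤ G R) : subsetExp p A F ≤ subsetExp p A G := by
  refine Finset.sum_le_sum fun R hR => mul_le_mul_of_nonneg_left (h R (Finset.mem_powerset.1 hR))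
    (Finset.prod_nonneg fun i _ => ?_)
  split_ifs
  · exact h0 i
  · linarith [h1 i]

lemma subsetExp_add (A : Finset ι) (F G : Finset ι → ℝ) :
    subsetExp p A (fun R => F R + G R) = subsetExp p A F + subsetExp p A G := by
  simp only [subsetExp, mul_add, Finset.sum_add_distrib]

@[simp] lemma subsetExp_zero (A : Finset ι) : subsetExp p A (fun _ => 0) = 0 := by
  simp [subsetExp]

lemma subsetExp_congr {A : Finset ι} {F G : Finset ι → ℝ} (h : ∀ R ⊆ A, F R = G R) :
    subsetExp p A F = subsetExp p A G :=
  Finset.sum_congr rfl fun R hR => by rw [h R (Finset.mem_powerset.1 hR)]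

lemma subsetExp_const (A : Finset ι) (c : ℝ) : subsetExp p A (fun _ => c) = c := by
  classical
  induction A using Finset.induction_on with
  | empty => simp
  | insert a A ha ih => rw [subsetExp_insert ha, ih]; ring

open Classical in
-- Coordinates outside `S` integrate out with total mass 1.
lemma subsetExp_inter (A S : Finset ι) (F : Finset ι → ℝ) :
    subsetExp p A (fun R => F (R ∩ S)) = subsetExp p (A ∩ S) F := by
  induction A using Finset.induction_on generalizing F with
  | empty => simp
  | insert a A ha ih =>
    rw [subsetExp_insert ha, ih]
    by_cases haS : a ∈ S
    · rw [Finset.insert_inter_of_mem haS,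
        subsetExp_insert (fun h => ha (Finset.mem_inter.1 h).1), ← ih (fun R => F (insert a R))]
      simp only [Finset.insert_inter_of_mem haS]
    · simp only [Finset.insert_inter_of_notMem haS, ih]
      ring

open Classical in
-- Conditioning on the last pair leaves the event for the earlier pairs untouched, since the `T k`
-- are disjoint. `A` varies so that the last pair can be removed from the ground set.
lemma subsetExp_no_pair_le (h1 : ∀ i, p i ≤ 1) {β : ℝ} (hβ : 0 ≤ β)
    (hp : ∀ i, β ≤ p i) (T : ℕ → Finset ι) (a b : ℕ → ι) (L : ℕ)
    (ha : ∀ k < L, a k ∈ T k) (hb : ∀ k < L, b k ∈ T k)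
    (hT : ∀ j < L, ∀ k < L, j ≠ k → Disjoint (T j) (T k))
    (A : Finset ι) (hA : ∀ k < L, a k ∈ A ∧ b k ∈ A) :
    subsetExp p A (fun R => if ∃ k < L, a k ∈ R ∧ b k ∈ R then 0 else 1) ≤ (1 - β ^ 2) ^ L := by
  have h0 : ∀ i, 0 ≤ p i := fun i => hβ.trans (hp i)
  induction L generalizing A with
  | zero => simp [subsetExp_const]
  | succ L ih =>
    have hne : ∀ k < L, ∀ x ∈ T L, a k ≠ x ∧ b k ≠ x := fun k hk x hx => by
      have hd := hT k (by omega) L (by omega) (by omega)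
      exact ⟨Finset.disjoint_iff_ne.1 hd _ (ha k (by omega)) _ hx,
        Finset.disjoint_iff_ne.1 hd _ (hb k (by omega)) _ hx⟩
    have haL := ha L (by omega)
    have hbL := hb L (by omega)
    set F : Finset ι → ℝ := fun R => if ∃ k < L + 1, a k ∈ R ∧ b k ∈ R then 0 else 1 with hF
    set G : Finset ι → ℝ := fun R => if ∃ k < L, a k ∈ R ∧ b k ∈ R then 0 else 1 with hG
    have hFG : ∀ R, F R ≤ G R := fun R => by
      simp only [hF, hG]
      split_ifs with h₁ h₂ h₂
      · exact le_rfl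
      · exact zero_le_one
      · exact absurd h₂ (fun ⟨k, hk, h⟩ => h₁ ⟨k, by omega, h⟩)
      · exact le_rfl
    have hF0 : ∀ R, a L ∈ R → b L ∈ R → F R = 0 := fun R h₁ h₂ =>
      if_pos ⟨L, by omega, h₁, h₂⟩
    have hGi : ∀ x ∈ T L, ∀ R, G (insert x R) = G R := fun x hx R => by
      have : (∃ k < L, a k ∈ insert x R ∧ b k ∈ insert x R) ↔ ∃ k < L, a k ∈ R ∧ b k ∈ R := by
        refine exists_congr fun k => and_congr_right fun hk => ?_
        simp [Finset.mem_insert, (hne k hk x hx).1, (hne k hk x hx).2]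
      simp only [hG, this]
    have ih' : ∀ B : Finset ι, (∀ k < L, a k ∈ B ∧ b k ∈ B) →
        subsetExp p B G ≤ (1 - β ^ 2) ^ L := fun B hB =>
      ih (fun k hk => ha k (by omega)) (fun k hk => hb k (by omega))
        (fun j hj k hk => hT j (by omega) k (by omega)) B hB
    have hβ1 : β ≤ 1 := (hp (a 0)).trans (h1 _)
    have hpow : 0 ≤ (1 - β ^ 2) ^ L := pow_nonneg (by nlinarith) _
    -- A pair may degenerate to one point, which is present with probability at least `β ≥ β ^ 2`.
    by_cases hab : a L = b L
    · set B := A.erase (a L) with hBdef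
      have hBA : insert (a L) B = A := Finset.insert_erase (hA L (by omega)).1
      have hB : subsetExp p B G ≤ (1 - β ^ 2) ^ L := ih' B fun k hk =>
        ⟨Finset.mem_erase.2 ⟨(hne k hk _ haL).1, (hA k (by omega)).1⟩,
          Finset.mem_erase.2 ⟨(hne k hk _ haL).2, (hA k (by omega)).2⟩⟩
      rw [← hBA, subsetExp_insert (Finset.notMem_erase _ _),
        subsetExp_congr (G := fun _ => 0) (fun R _ => hF0 _ (Finset.mem_insert_self _ _)
          (hab ▸ Finset.mem_insert_self _ _)), subsetExp_zero, mul_zero, zero_add, pow_succ,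
        mul_comm ((1 - β ^ 2) ^ L)]
      refine mul_le_mul ?_ ((subsetExp_mono h0 h1 fun R _ => hFG R).trans hB) ?_ (by nlinarith)
      · nlinarith [hp (a L)]
      · rw [← subsetExp_zero (p := p) B]
        exact subsetExp_mono h0 h1 fun R _ => by simp only [hF]; split_ifs <;> norm_num
    · set B := (A.erase (a L)).erase (b L) with hBdef
      have hbA : b L ∈ A.erase (a L) := Finset.mem_erase.2 ⟨Ne.symm hab, (hA L (by omega)).2⟩
      have hB₁ : insert (b L) B = A.erase (a L) := Finset.insert_erase hbA
      have hBA : insert (a L) (insert (b L) B) = A := by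
        rw [hB₁, Finset.insert_erase (hA L (by omega)).1]
      have hB : subsetExp p B G ≤ (1 - β ^ 2) ^ L := ih' B fun k hk =>
        ⟨Finset.mem_erase.2 ⟨(hne k hk _ hbL).1,
          Finset.mem_erase.2 ⟨(hne k hk _ haL).1, (hA k (by omega)).1⟩⟩,
          Finset.mem_erase.2 ⟨(hne k hk _ hbL).2,
          Finset.mem_erase.2 ⟨(hne k hk _ haL).2, (hA k (by omega)).2⟩⟩⟩
      have hbB : b L ∉ B := Finset.notMem_erase _ _
      have haB : a L ∉ insert (b L) B := by rw [hB₁]; exact Finset.notMem_erase _ _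
      have h₁ : subsetExp p B (fun R => F (insert (a L) (insert (b L) R))) = 0 := by
        rw [subsetExp_congr (G := fun _ => 0) (fun R _ => hF0 _ (Finset.mem_insert_self _ _)
          (Finset.mem_insert_of_mem (Finset.mem_insert_self _ _))), subsetExp_zero]
      have h₂ : subsetExp p B (fun R => F (insert (a L) R)) ≤ (1 - β ^ 2) ^ L :=
        (subsetExp_mono h0 h1 fun R _ => (hFG _).trans (hGi _ haL R).le).trans hB
      have h₃ : subsetExp p B (fun R => F (insert (b L) R)) ≤ (1 - β ^ 2) ^ L :=
        (subsetExp_mono h0 h1 fun R _ => (hFG _).trans (hGi _ hbL R).le).trans hB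
      have h₄ : subsetExp p B F ≤ (1 - β ^ 2) ^ L :=
        (subsetExp_mono h0 h1 fun R _ => hFG _).trans hB
      rw [← hBA, subsetExp_insert haB, subsetExp_insert hbB, subsetExp_insert hbB, h₁]
      set X := (1 - β ^ 2) ^ L with hX
      set x := p (a L)
      set y := p (b L)
      have hx0 : 0 ≤ x := h0 _
      have hy0 : 0 ≤ y := h0 _
      have hx1 : 0 ≤ 1 - x := sub_nonneg.2 (h1 _)
      have hy1 : 0 ≤ 1 - y := sub_nonneg.2 (h1 _)
      have hxy : β ^ 2 ≤ x * y := by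
        rw [pow_two]; exact mul_le_mul (hp _) (hp _) hβ hx0
      calc _ ≤ x * (y * 0 + (1 - y) * X) + (1 - x) * (y * X + (1 - y) * X) := by gcongr
        _ = (1 - x * y) * X := by ring
        _ ≤ (1 - β ^ 2) * X := by gcongr
        _ = (1 - β ^ 2) ^ (L + 1) := by rw [hX, pow_succ (1 - β ^ 2) L, mul_comm]

end PartialExp

/-! ### Coupling of a subfamily with the full family. -/

namespace ExistentialModel

variable {d : ℕ} {ι : Type*} [Fintype ι] (P : ExistentialModel d ι)

open Classical in
lemma pr_eq_subsetExp (E : Finset ι → Prop) :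
    P.pr E = subsetExp P.prob Finset.univ (fun R => if E R then 1 else 0) := by
  simp only [pr, subsetExp, weight, Finset.powerset_univ, mul_ite, mul_one, mul_zero]

lemma pr_mono {E F : Finset ι → Prop} (h : ∀ R, E R → F R) : P.pr E ≤ P.pr F := by
  classical
  rw [pr_eq_subsetExp, pr_eq_subsetExp]
  refine subsetExp_mono P.prob_nonneg P.prob_le_one fun R _ => ?_
  split_ifs with h₁ h₂ h₂
  · exact le_rfl
  · exact absurd (h R h₁) h₂
  · exact zero_le_one
  · exact le_rfl

open Classical in
lemma pr_restrict (S : Finset ι) (E : Finset ι → Prop) :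
    (P.restrict S).pr (fun T => E (T.map (Function.Embedding.subtype _))) =
      P.pr (fun R => E (R ∩ S)) := by
  rw [P.pr_eq_subsetExp, subsetExp_inter Finset.univ S (fun R => if E R then 1 else 0),
    Finset.univ_inter, pr, subsetExp]
  refine Finset.sum_nbij' (fun T => T.map (Function.Embedding.subtype _))
    (fun R => R.subtype (· ∈ S)) ?_ ?_ ?_ ?_ ?_
  · intro T _
    simp only [Finset.mem_powerset]
    intro i hi
    simp only [Finset.mem_map, Function.Embedding.subtype_apply] at hi
    obtain ⟨j, -, rfl⟩ := hi
    exact j.2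
  · intro R _; simp
  · intro T _
    ext j; simp
  · intro R hR
    rw [Finset.subtype_map_of_mem]
    exact fun x hx => Finset.mem_powerset.1 hR hx
  · intro T _
    rw [mul_ite, mul_one, mul_zero, weight, ← Finset.prod_coe_sort S]
    congr 1
    refine Finset.prod_congr rfl fun j _ => ?_
    simp [restrict]

open Classical in
lemma widthCDF_restrict (S : Finset ι) (u : EuclideanSpace ℝ (Fin d)) (t : ℝ) :
    (P.restrict S).widthCDF u t =
      P.pr (fun R => dirWidth (P.loc '' ((R ∩ S : Finset ι) : Set ι)) u ≤ t) := by
  rw [← P.pr_restrict S (fun R => dirWidth (P.loc '' (R : Set ι)) u ≤ t), widthCDF]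
  congr! 4 with T
  simp [Set.image_image, restrict]

lemma widthCDF_mono (u : EuclideanSpace ℝ (Fin d)) {s t : ℝ} (h : s ≤ t) :
    P.widthCDF u s ≤ P.widthCDF u t :=
  P.pr_mono fun _ hR => hR.trans h

end ExistentialModel

/-! ### Greedy basis with bounded coefficients. -/

section GreedyBasis

variable {E : Type*} [NormedAddCommGroup E] [InnerProductSpace ℝ E] [FiniteDimensional ℝ E]
  {ι : Type*}

/-- In a finite family of vectors that contains `0`, there are `m` members, where `m` bounds the
dimension of the span, such that the whole family consists of combinations of them with bounded
coefficients. -/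
lemma exists_bounded_combination (P : Finset ι) {i₀ : ι} (hi₀ : i₀ ∈ P) (m : ℕ) (q : ι → E)
    (hq₀ : q i₀ = 0) (hm : Module.finrank ℝ (Submodule.span ℝ (q '' (P : Set ι))) ≤ m) :
    ∃ (σ : Fin m → ι) (t : ι → Fin m → ℝ), (∀ j, σ j ∈ P) ∧
      ∀ i ∈ P, q i = ∑ j, t i j • q (σ j) ∧ ∑ j, |t i j| ≤ 2 ^ m - 1 := by
  induction m generalizing q with
  | zero =>
    refine ⟨Fin.elim0, fun _ => Fin.elim0, fun j => j.elim0, fun i hi => ?_⟩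
    have h := Submodule.finrank_eq_zero.1 (Nat.le_zero.1 hm)
    have : q i ∈ Submodule.span ℝ (q '' (P : Set ι)) := Submodule.subset_span ⟨i, hi, rfl⟩
    rw [h, Submodule.mem_bot] at this
    simp [this]
  | succ m ih =>
    -- Projecting along the longest vector keeps every coefficient at most 1 in absolute value; if
    -- it is nonzero, the residuals span a smaller space. If it is zero, all vectors vanish and
    -- division by zero sets `c` to 0.
    obtain ⟨s, hs, hmax⟩ := P.exists_max_image (fun i => ‖q i‖) ⟨i₀, hi₀⟩
    set c : ι → ℝ := fun i => inner ℝ (q s) (q i) / ‖q s‖ ^ 2 with hc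
    have hc1 : ∀ i ∈ P, |c i| ≤ 1 := fun i hi => by
      rw [hc, abs_div, abs_of_nonneg (sq_nonneg ‖q s‖)]
      refine div_le_one_of_le₀ ((abs_real_inner_le_norm _ _).trans ?_) (sq_nonneg _)
      rw [pow_two]
      exact mul_le_mul_of_nonneg_left (hmax i hi) (norm_nonneg _)
    set q' : ι → E := fun i => q i - c i • q s with hq'
    have hrank : Module.finrank ℝ (Submodule.span ℝ (q' '' (P : Set ι))) ≤ m := by
      by_cases h0 : q s = 0
      · have hz : ∀ i ∈ P, q' i = 0 := fun i hi => by
          have := hmax i hi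
          simp only [h0, norm_zero, norm_le_zero_iff] at this
          simp [hq', this, h0]
        have : Submodule.span ℝ (q' '' (P : Set ι)) = ⊥ := by
          rw [Submodule.span_eq_bot]
          rintro _ ⟨i, hi, rfl⟩
          exact hz i hi
        rw [this, finrank_bot]
        exact Nat.zero_le _
      · have hmem : ∀ i ∈ P, q i ∈ Submodule.span ℝ (q '' (P : Set ι)) := fun i hi =>
          Submodule.subset_span ⟨i, hi, rfl⟩
        have hle : Submodule.span ℝ (q' '' (P : Set ι)) ≤ Submodule.span ℝ (q '' (P : Set ι)) := by
          rw [Submodule.span_le]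
          rintro _ ⟨i, hi, rfl⟩
          exact Submodule.sub_mem _ (hmem i hi) (Submodule.smul_mem _ _ (hmem s hs))
        have horth : Submodule.span ℝ (q' '' (P : Set ι)) ≤ (Submodule.span ℝ {q s})ᗮ := by
          rw [Submodule.span_le]
          rintro _ ⟨i, hi, rfl⟩
          rw [SetLike.mem_coe, Submodule.mem_orthogonal_singleton_iff_inner_right]
          have : ‖q s‖ ^ 2 ≠ 0 := pow_ne_zero _ (norm_ne_zero_iff.2 h0)
          simp only [hq', hc]
          rw [inner_sub_right, inner_smul_right, real_inner_self_eq_norm_sq,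
            div_mul_cancel₀ _ this, sub_self]
        have hlt : Submodule.span ℝ (q' '' (P : Set ι)) < Submodule.span ℝ (q '' (P : Set ι)) := by
          refine lt_of_le_of_ne hle fun h => h0 ?_
          have := horth (h ▸ hmem s hs)
          rw [Submodule.mem_orthogonal_singleton_iff_inner_right] at this
          exact inner_self_eq_zero.1 this
        have := Submodule.finrank_lt_finrank_of_lt hlt
        omega
    obtain ⟨σ, t, hσ, ht⟩ := ih q' (by simp [hq', hc, hq₀]) hrank
    refine ⟨Fin.cons s σ, fun i => Fin.cons (c i - ∑ j, t i j * c (σ j)) (t i), fun j => ?_,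
      fun i hi => ⟨?_, ?_⟩⟩
    · refine Fin.cases ?_ (fun j => ?_) j
      · simpa using hs
      · simpa using hσ j
    · have h := (ht i hi).1
      have h' : q i = q' i + c i • q s := by simp [hq']
      rw [h', h, Fin.sum_univ_succ]
      simp only [Fin.cons_zero, Fin.cons_succ, hq', smul_sub, Finset.sum_sub_distrib, sub_smul,
        Finset.sum_smul, mul_smul]
      abel
    · have h := (ht i hi).2
      rw [Fin.sum_univ_succ]
      simp only [Fin.cons_zero, Fin.cons_succ]
      have h₁ : |∑ j, t i j * c (σ j)| ≤ ∑ j, |t i j| :=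
        (Finset.abs_sum_le_sum_abs _ _).trans (Finset.sum_le_sum fun j _ => by
          rw [abs_mul]
          exact mul_le_of_le_one_right (abs_nonneg _) (hc1 _ (hσ j)))
      have h₂ := abs_sub (c i) (∑ j, t i j * c (σ j))
      have h₃ := hc1 i hi
      -- The bound doubles and gains one: `1 + 2 * (2 ^ m - 1) = 2 ^ (m + 1) - 1`.
      rw [pow_succ]
      linarith

end GreedyBasis

/-! ### Kernels from a net on the boundary of a cube. -/

section CubeNet

variable {ι : Type*}

lemma exists_grid_near {N : ℕ} (hN : 0 < N) {x : ℝ} (hx : |x| ≤ 2) :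
    ∃ g : Fin N, |(-2 + 4 / (N : ℝ) * (g : ℕ)) - x| ≤ 4 / N := by
  have hN' : (0 : ℝ) < N := Nat.cast_pos.2 hN
  obtain ⟨hx1, hx2⟩ := abs_le.1 hx
  set z : ℝ := (x + 2) / 4 * N with hz
  have hz0 : 0 ≤ z := by
    have : 0 ≤ x + 2 := by linarith
    positivity
  have hzN : z ≤ N := mul_le_of_le_one_left hN'.le (by linarith)
  have hxz : x = -2 + 4 / N * z := by
    rw [hz]; field_simp; ring
  have main : ∃ g : Fin N, ((g : ℕ) : ℝ) ≤ z ∧ z ≤ (g : ℕ) + 1 := by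
    rcases lt_or_ge ⌊z⌋₊ N with h | h
    · exact ⟨⟨_, h⟩, Nat.floor_le hz0, (Nat.lt_floor_add_one z).le⟩
    -- The grid omits the endpoint 2, which is served by the last grid point at distance exactly `4
    -- / N`.
    · have hNz : (N : ℝ) ≤ z := (Nat.cast_le.2 h).trans (Nat.floor_le hz0)
      refine ⟨⟨N - 1, by omega⟩, ?_, ?_⟩ <;> simp only [Nat.cast_sub hN, Nat.cast_one] <;> linarith
  obtain ⟨g, hg1, hg2⟩ := main
  refine ⟨g, ?_⟩
  have : (-2 + 4 / (N : ℝ) * (g : ℕ)) - x = 4 / N * ((g : ℕ) - z) := by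
    rw [hxz]; ring
  rw [this, abs_mul, abs_of_pos (by positivity)]
  exact mul_le_of_le_one_right (by positivity) (abs_le.2 ⟨by linarith, by linarith⟩)

/-- The sup norm along the ray passes from at most 1 to at least 2. The coordinate attaining 2 has
moved by at least 1, which bounds `s` from below. -/
lemma exists_ray_boundary {m : ℕ} {x u : Fin (m + 1) → ℝ} (hx : ∀ j, |x j| ≤ 1) (hu : u ≠ 0) :
    ∃ s : ℝ, 0 < s ∧ (∀ j, |x j + s * u j| ≤ 2) ∧ ∃ i, |x i + s * u i| = 2 ∧ 1 ≤ s * |u i| := by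
  have hu' : 0 < ‖u‖ := norm_pos_iff.2 hu
  have hx' : ‖x‖ ≤ 1 := (pi_norm_le_iff_of_nonneg zero_le_one).2 hx
  have hcont : ContinuousOn (fun s : ℝ => ‖x + s • u‖) (Set.Icc 0 (3 / ‖u‖)) := by fun_prop
  have hmem : (2 : ℝ) ∈ Set.Icc ‖x + (0 : ℝ) • u‖ ‖x + (3 / ‖u‖) • u‖ := by
    constructor
    · simp; linarith
    · have h₁ : ‖(3 / ‖u‖) • u‖ = 3 := by
        rw [norm_smul, Real.norm_of_nonneg (by positivity)]; field_simp
      have h₂ := norm_sub_le (x + (3 / ‖u‖) • u) x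
      rw [add_sub_cancel_left, h₁] at h₂
      linarith
  obtain ⟨s, ⟨hs0, -⟩, hs⟩ := intermediate_value_Icc (by positivity) hcont hmem
  simp only at hs
  have hle : ∀ j, |x j + s * u j| ≤ 2 := fun j => by
    simpa [hs] using norm_le_pi_norm (x + s • u) j
  have hex : ∃ i, |x i + s * u i| = 2 := by
    by_contra! h
    have : ‖x + s • u‖ < 2 := (pi_norm_lt_iff two_pos).2 fun i => lt_of_le_of_ne (hle i) (h i)
    linarith
  obtain ⟨i, hi⟩ := hex
  have h1 : 1 ≤ s * |u i| := by
    have := abs_add_le (x i) (s * u i)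
    rw [hi, abs_mul, abs_of_nonneg hs0] at this
    linarith [hx i]
  refine ⟨s, lt_of_le_of_ne hs0 fun h => ?_, hle, i, hi, h1⟩
  rw [← h, zero_mul] at h1
  linarith

/-- For a point `y` near the ray from `x` in direction `u`, a point at least as close to `y` as
`x` is almost as extreme in direction `u`. -/
lemma sum_mul_le_of_nearest {κ : Type*} [Fintype κ] {x y z u : κ → ℝ} {s r : ℝ} (hs : 0 < s)
    (he : ∑ j, (y j - (x j + s * u j)) ^ 2 ≤ r)
    (hz : ∑ j, (y j - z j) ^ 2 ≤ ∑ j, (y j - x j) ^ 2) :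
    ∑ j, u j * x j ≤ ∑ j, u j * z j + r / (2 * s) := by
  have h : ∑ j, ((y j - x j) ^ 2 - (y j - z j) ^ 2) ≤
      ∑ j, (2 * s * (u j * z j) - 2 * s * (u j * x j) + (y j - (x j + s * u j)) ^ 2) :=
    Finset.sum_le_sum fun j _ => by
      -- With `e = y - (x + s u)`, this is `2 e (z - x) - (z - x) ^ 2 ≤ e ^ 2`; the error enters
      -- only squared.
      nlinarith [sq_nonneg ((y j - (x j + s * u j)) - (z j - x j))]
  rw [Finset.sum_sub_distrib, Finset.sum_add_distrib, Finset.sum_sub_distrib, ← Finset.mul_sum,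
    ← Finset.mul_sum] at h
  have h' : 2 * s * (∑ j, u j * x j - ∑ j, u j * z j) ≤ r := by linarith
  rw [← sub_le_iff_le_add', le_div_iff₀ (by positivity)]
  linarith

/-- The net has `N ^ m` grid points on each of the `2 * (m + 1)` facets of the cube `[-2, 2] ^ (m +
1)`; `Q` collects one nearest member of the family for each. -/
lemma exists_cube_kernel (m : ℕ) {N : ℕ} (hN : 0 < N) {P : Finset ι} (hP : P.Nonempty)
    {t : ι → Fin (m + 1) → ℝ} (ht : ∀ i ∈ P, ∀ j, |t i j| ≤ 1) :
    ∃ Q ⊆ P, Q.Nonempty ∧ Q.card ≤ 2 * (m + 1) * N ^ m ∧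
      ∀ (u : Fin (m + 1) → ℝ) (w : ℝ), (∀ j, |u j| ≤ w) → ∀ p ∈ P, ∃ q ∈ Q,
        ∑ j, u j * t p j ≤ ∑ j, u j * t q j + (m + 1) * (4 / (N : ℝ)) ^ 2 / 2 * w := by
  classical
  choose φ hφP hφ using fun y : Fin (m + 1) → ℝ =>
    P.exists_min_image (fun i => ∑ j, (y j - t i j) ^ 2) hP
  let net : Fin (m + 1) × Bool × (Fin m → Fin N) → Fin (m + 1) → ℝ := fun k =>
    k.1.insertNth (if k.2.1 then (2 : ℝ) else -2) (fun j => -2 + 4 / (N : ℝ) * (k.2.2 j : ℕ))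
  have : Nonempty (Fin N) := ⟨⟨0, hN⟩⟩
  refine ⟨Finset.univ.image fun k => φ (net k), ?_, Finset.univ_nonempty.image _, ?_, ?_⟩
  · intro i hi
    obtain ⟨k, -, rfl⟩ := Finset.mem_image.1 hi
    exact hφP _
  · refine Finset.card_image_le.trans (le_of_eq ?_)
    simp only [Finset.card_univ, Fintype.card_prod, Fintype.card_fin, Fintype.card_bool,
      Fintype.card_pi, Finset.prod_const]
    ring
  · intro u w hw p hp
    by_cases hu : u = 0
    · refine ⟨φ (net (0, true, fun _ => ⟨0, hN⟩)), Finset.mem_image_of_mem _ (Finset.mem_univ _), ?_⟩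
      have : 0 ≤ w := (abs_nonneg _).trans (hw 0)
      simp only [hu, Pi.zero_apply, zero_mul, Finset.sum_const_zero, zero_add]
      positivity
    · obtain ⟨s, hs, hle, i, hi, his⟩ := exists_ray_boundary (ht p hp) hu
      choose g hg using fun j : Fin m => exists_grid_near hN (hle (i.succAbove j))
      obtain ⟨b, hb⟩ : ∃ b : Bool, (if b then (2 : ℝ) else -2) = t p i + s * u i := by
        rcases (abs_eq (zero_le_two)).1 hi with h | h
        · exact ⟨true, by simp [h]⟩
        · exact ⟨false, by simp [h]⟩
      refine ⟨φ (net (i, b, g)), Finset.mem_image_of_mem _ (Finset.mem_univ _), ?_⟩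
      have he : ∑ j, (net (i, b, g) j - (t p j + s * u j)) ^ 2 ≤ (m + 1) * (4 / (N : ℝ)) ^ 2 := by
        calc _ ≤ ∑ j : Fin (m + 1), (4 / (N : ℝ)) ^ 2 := Finset.sum_le_sum fun j _ => by
              rw [← sq_abs]
              refine pow_le_pow_left₀ (abs_nonneg _) ?_ 2
              refine Fin.succAboveCases i ?_ (fun j => ?_) j
              · simp only [net, Fin.insertNth_apply_same, hb, sub_self, abs_zero]
                positivity
              · simpa only [net, Fin.insertNth_apply_succAbove] using hg j
          _ = _ := by simp
      have hmain := sum_mul_le_of_nearest hs he (hφ (net (i, b, g)) p hp)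
      refine hmain.trans ?_
      gcongr
      rw [div_le_iff₀ (by positivity)]
      have : 1 ≤ s * w := his.trans (mul_le_mul_of_nonneg_left (hw i) hs.le)
      have h0 : 0 ≤ ((m : ℝ) + 1) * (4 / (N : ℝ)) ^ 2 := by positivity
      nlinarith

end CubeNet

/-- Every finite family of points in `ℝ^d` has a `δ`-kernel of size `O(δ^(-(d-1)/2))`. -/
theorem exists_isKernel (d : ℕ) (hd : 1 ≤ d) :
    ∃ C₀ : ℝ, 0 < C₀ ∧ ∀ {ι : Type} (loc : ι → EuclideanSpace ℝ (Fin d)) (δ : ℝ), 0 < δ → δ ≤ 1 →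
      ∀ P : Finset ι, ∃ Q, IsKernel loc δ P Q ∧
        (Q.card : ℝ) ≤ C₀ * (1 / δ) ^ (((d : ℝ) - 1) / 2) := by
  obtain ⟨m, rfl⟩ : ∃ m, d = m + 1 := ⟨d - 1, by omega⟩
  set B : ℝ := 2 ^ (m + 1) with hB
  have hBpos : 0 < B := by positivity
  -- Chosen so that `N ≥ κ * √(1 / δ)` yields `hN2`, a loss of `δ / 2` of the width at each end.
  set κ : ℝ := Real.sqrt (16 * (m + 1) * B) with hκ
  have hκpos : 0 < κ := Real.sqrt_pos.2 (by positivity)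
  refine ⟨2 * (m + 1) * (κ + 1) ^ m, by positivity, fun {ι} loc δ hδ hδ1 P => ?_⟩
  rcases P.eq_empty_or_nonempty with rfl | hP
  · refine ⟨∅, ⟨le_rfl, id, fun u => by simp⟩, ?_⟩
    simp only [Finset.card_empty, Nat.cast_zero]
    positivity
  have hPn := hP
  obtain ⟨i₀, hi₀⟩ := hP
  obtain ⟨σ, t, hσ, ht⟩ := exists_bounded_combination P hi₀ (m + 1) (fun i => loc i - loc i₀)
    (sub_self _) ((Submodule.finrank_le _).trans (by simp))
  set r : ℝ := Real.sqrt (1 / δ) with hr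
  have hr1 : 1 ≤ r := Real.one_le_sqrt.2 (by rwa [le_div_iff₀ hδ, one_mul])
  have hr2 : r ^ 2 = 1 / δ := Real.sq_sqrt (by positivity)
  set N : ℕ := ⌈κ * r⌉₊ with hN
  have hNpos : 0 < N := Nat.ceil_pos.2 (by positivity)
  have hNle : κ * r ≤ N := Nat.le_ceil _
  have hNge : (N : ℝ) ≤ (κ + 1) * r := by
    have := Nat.ceil_lt_add_one (a := κ * r) (by positivity)
    rw [← hN] at this
    linarith
  have hN2 : (m + 1) * (4 / (N : ℝ)) ^ 2 * B ≤ δ := by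
    have h₁ : (κ * r) ^ 2 ≤ (N : ℝ) ^ 2 := pow_le_pow_left₀ (by positivity) hNle 2
    rw [mul_pow, hr2, hκ, Real.sq_sqrt (by positivity), mul_one_div, div_le_iff₀ hδ] at h₁
    rw [div_pow, mul_div_assoc', div_mul_eq_mul_div, div_le_iff₀ (by positivity)]
    linarith
  have htB : ∀ i ∈ P, ∀ j, |t i j / B| ≤ 1 := fun i hi j => by
    rw [abs_div, abs_of_pos hBpos, div_le_one hBpos]
    have h₁ := (ht i hi).2
    have h₂ := Finset.single_le_sum (f := fun j => |t i j|) (fun _ _ => abs_nonneg _)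
      (Finset.mem_univ j)
    linarith
  obtain ⟨Q, hQP, hQne, hcard, hQ⟩ := exists_cube_kernel m hNpos hPn htB
  have hfin : ∀ R : Finset ι, (loc '' (R : Set ι)).Finite := fun R => R.finite_toSet.image _
  have happrox : ∀ u : EuclideanSpace ℝ (Fin (m + 1)), ∀ p ∈ P, ∃ q ∈ Q,
      inner ℝ u (loc p) ≤ inner ℝ u (loc q) + δ / 2 * dirWidth (loc '' (P : Set ι)) u := by
    intro u p hp
    have hrep : ∀ i ∈ P, ∑ j, B * inner ℝ u (loc (σ j) - loc i₀) * (t i j / B) =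
        inner ℝ u (loc i) - inner ℝ u (loc i₀) := fun i hi => by
      rw [← inner_sub_right, (ht i hi).1, inner_sum]
      refine Finset.sum_congr rfl fun j _ => ?_
      rw [inner_smul_right]
      field_simp
    -- In the coordinates `t / B`, `u` becomes this functional. Its entries are `B` times
    -- differences within `P`, hence at most `B` times the width.
    obtain ⟨q, hq, hle⟩ := hQ (fun j => B * inner ℝ u (loc (σ j) - loc i₀))
      (B * dirWidth (loc '' (P : Set ι)) u) (fun j => by
        rw [abs_mul, abs_of_pos hBpos, inner_sub_right]
        refine mul_le_mul_of_nonneg_left (abs_sub_le_iff.2 ⟨?_, ?_⟩) hBpos.le <;>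
        exact inner_sub_inner_le_dirWidth (hfin P) ⟨_, by first | exact hσ j | exact hi₀, rfl⟩
          ⟨_, by first | exact hi₀ | exact hσ j, rfl⟩) p hp
    rw [hrep p hp, hrep q (hQP hq)] at hle
    refine ⟨q, hq, ?_⟩
    have hw : 0 ≤ dirWidth (loc '' (P : Set ι)) u := dirWidth_nonneg (hfin P)
    have := mul_le_mul_of_nonneg_right hN2 hw
    linarith
  refine ⟨Q, ⟨hQP, fun _ => hQne, fun u => ⟨?_, ?_⟩⟩, ?_⟩
  · obtain ⟨_, ⟨a, ha, rfl⟩, _, ⟨b, hb, rfl⟩, hab, -⟩ := exists_dirWidth_eq (u := u) (hfin P)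
      ((Finset.coe_nonempty.2 hPn).image _)
    obtain ⟨q, hq, hqa⟩ := happrox u a ha
    obtain ⟨q', hq', hqb⟩ := happrox (-u) b hb
    have hneg : dirWidth (loc '' (P : Set ι)) (-u) = dirWidth (loc '' (P : Set ι)) u := by
      simp [dirWidth, add_comm]
    rw [hneg, inner_neg_left, inner_neg_left] at hqb
    have := inner_sub_inner_le_dirWidth (u := u) (hfin Q) ⟨q, hq, rfl⟩ ⟨q', hq', rfl⟩
    linarith
  · exact dirWidth_mono (hfin P) (Set.image_mono (Finset.coe_subset.2 hQP))
  · have hpow : (1 / δ) ^ ((((m + 1 : ℕ) : ℝ) - 1) / 2) = r ^ m := by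
      rw [hr, Real.sqrt_eq_rpow, ← Real.rpow_natCast, ← Real.rpow_mul (by positivity)]
      congr 1
      push_cast
      ring
    rw [hpow]
    calc (Q.card : ℝ) ≤ 2 * (m + 1) * (N : ℝ) ^ m := by exact_mod_cast hcard
      _ ≤ 2 * (m + 1) * ((κ + 1) * r) ^ m := by gcongr
      _ = _ := by rw [mul_pow]; ring

/-! ### The peeling construction and its failure probability. -/

section Peeling

variable {d : ℕ} {ι : Type*}

lemma subset_layers (S : ℕ → Finset ι) {j k : ℕ} (h : j < k) : S j ⊆ layers S k := by
  classical
  exact Finset.subset_biUnion_of_mem S (Finset.mem_range.2 h)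

lemma layers_mono (S : ℕ → Finset ι) {j k : ℕ} (h : j ≤ k) : layers S j ⊆ layers S k := by
  classical
  exact Finset.biUnion_subset_biUnion_of_subset_left S (Finset.range_mono h)

variable [Fintype ι] {loc : ι → EuclideanSpace ℝ (Fin d)}

open Classical in
lemma exists_isPeelingRun {δ M : ℝ}
    (h : ∀ P : Finset ι, ∃ Q, IsKernel loc δ P Q ∧ (Q.card : ℝ) ≤ M) (L : ℕ) :
    ∃ S : ℕ → Finset ι, IsPeelingRun loc δ M L S := by
  choose ker hker using h
  let T : ℕ → Finset ι := fun k => Nat.rec ∅ (fun _ A => A ∪ ker (Finset.univ \ A)) k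
  have hT : ∀ k, layers (fun k => ker (Finset.univ \ T k)) k = T k := by
    intro k
    induction k with
    | zero => simp [layers, T]
    | succ k ih =>
      rw [layers, Finset.range_add_one, Finset.biUnion_insert, Finset.union_comm]
      change layers _ k ∪ _ = _
      rw [ih]
  refine ⟨fun k => ker (Finset.univ \ T k), fun k _ => ?_⟩
  rw [hT]
  convert hker (Finset.univ \ T k)

lemma IsPeelingRun.card_layers_le {δ M : ℝ} {L : ℕ} {S : ℕ → Finset ι}
    (h : IsPeelingRun loc δ M L S) : ((layers S L).card : ℝ) ≤ L * M := by
  classical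
  calc ((layers S L).card : ℝ) ≤ ((∑ k ∈ Finset.range L, (S k).card : ℕ) : ℝ) :=
        Nat.cast_le.2 Finset.card_biUnion_le
    _ = ∑ k ∈ Finset.range L, ((S k).card : ℝ) := by push_cast; rfl
    _ ≤ ∑ k ∈ Finset.range L, M :=
        Finset.sum_le_sum fun k hk => (h k (Finset.mem_range.1 hk)).2
    _ = L * M := by simp

lemma IsPeelingRun.disjoint {δ M : ℝ} {L : ℕ} {S : ℕ → Finset ι}
    (h : IsPeelingRun loc δ M L S) {j k : ℕ} (hj : j < L) (hk : k < L) (hjk : j ≠ k) :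
    Disjoint (S j) (S k) := by
  classical
  wlog hlt : j < k generalizing j k
  · exact (this hk hj hjk.symm (by omega)).symm
  refine Finset.disjoint_left.2 fun x hx hx' => ?_
  exact (Finset.mem_sdiff.1 ((h k hk).1.1 hx')).2 (subset_layers S hlt hx)

lemma IsPeelingRun.widthCDF_restrict_le {P : ExistentialModel d ι} {δ M μ β : ℝ} {L : ℕ}
    {S : ℕ → Finset ι} (h : IsPeelingRun P.loc δ M L S) (hβ : 0 ≤ β) (hp : ∀ i, β ≤ P.prob i)
    (hδ : 0 ≤ δ) (hδμ : 4 * δ ≤ μ) (hμ : μ ≤ 1 / 2) (hL : (1 - β ^ 2) ^ L ≤ μ)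
    (u : EuclideanSpace ℝ (Fin d)) {x : ℝ} (hx : 0 ≤ x) :
    (P.restrict (layers S L)).widthCDF u x ≤ P.widthCDF u ((1 + μ) * x) + μ := by
  classical
  have hμ0 : 0 ≤ μ := by linarith
  rw [P.widthCDF_restrict]
  have hL0 : 0 < L := by
    rcases Nat.eq_zero_or_pos L with rfl | hL0
    · norm_num at hL; linarith
    · exact hL0
  -- If the points run out, the layers exhaust the family and there is nothing to approximate.
  by_cases hne : ∀ k < L, (Finset.univ \ layers S k).Nonempty
  · have hpair := fun k (hk : k < L) => (h k hk).1.exists_pair (by convert hne k hk) u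
    obtain ⟨i, -⟩ := hne 0 hL0
    have : Nonempty ι := ⟨i⟩
    choose! a ha b hb hab using hpair
    have hfail := subsetExp_no_pair_le P.prob_le_one hβ hp S a b L ha hb
      (fun j hj k hk => h.disjoint hj hk) Finset.univ
      (fun k _ => ⟨Finset.mem_univ _, Finset.mem_univ _⟩)
    rw [P.pr_eq_subsetExp, ExistentialModel.widthCDF, P.pr_eq_subsetExp]
    refine le_trans ?_ (add_le_add_right (hfail.trans hL) _)
    rw [← subsetExp_add]
    refine subsetExp_mono P.prob_nonneg P.prob_le_one fun R _ => ?_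
    by_cases hR : ∃ k < L, a k ∈ R ∧ b k ∈ R
    · rw [if_pos hR, add_zero]
      obtain ⟨k, hk, hak, hbk⟩ := hR
      by_cases hle : dirWidth (P.loc '' ((R ∩ layers S L : Finset ι) : Set ι)) u ≤ x
      · have hbig := dirWidth_le_of_pair_mem (A := R ∩ layers S L) (B := R) hδ hδμ hμ
          (fun p hpR => by
            by_cases hpL : p ∈ layers S L
            · exact Or.inl (Finset.mem_inter.2 ⟨hpR, hpL⟩)
            · exact Or.inr (Finset.mem_sdiff.2
                ⟨Finset.mem_univ _, fun h' => hpL (layers_mono S hk.le h')⟩))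
          (Finset.mem_inter.2 ⟨hak, subset_layers S hk (ha k hk)⟩)
          (Finset.mem_inter.2 ⟨hbk, subset_layers S hk (hb k hk)⟩) (hab k hk).1 (hab k hk).2
        rw [if_pos hle, if_pos (hbig.trans (mul_le_mul_of_nonneg_left hle (by linarith)))]
      · rw [if_neg hle]
        split_ifs <;> norm_num
    · rw [if_neg hR]
      split_ifs <;> norm_num
  · push Not at hne
    obtain ⟨k, hk, hempty⟩ := hne
    have hall : layers S L = Finset.univ := Finset.univ_subset_iff.1
      ((Finset.sdiff_eq_empty_iff_subset.1 hempty).trans (layers_mono S hk.le))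
    simp only [hall, Finset.inter_univ]
    have : x ≤ (1 + μ) * x := by nlinarith
    exact (P.widthCDF_mono u this).trans (le_add_of_nonneg_right hμ0)

lemma widthCDF_le_widthCDF_restrict (P : ExistentialModel d ι) (S : Finset ι)
    (u : EuclideanSpace ℝ (Fin d)) (x : ℝ) :
    P.widthCDF u x ≤ (P.restrict S).widthCDF u x := by
  classical
  rw [P.widthCDF_restrict]
  exact P.pr_mono fun R hR => (dirWidth_mono (R.finite_toSet.image _)
    (Set.image_mono (Finset.coe_subset.2 Finset.inter_subset_left))).trans hR

lemma one_sub_sq_pow_le {β μ : ℝ} {L : ℕ} (hβ : 0 < β) (hβ1 : β ≤ 1) (hμ : 0 < μ)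
    (hL : 1 / β ^ 2 * Real.log (1 / μ) ≤ L) : (1 - β ^ 2) ^ L ≤ μ := by
  have h0 : 0 ≤ 1 - β ^ 2 := by nlinarith
  calc (1 - β ^ 2) ^ L ≤ Real.exp (-β ^ 2) ^ L :=
        pow_le_pow_left₀ h0 (by linarith [Real.add_one_le_exp (-β ^ 2)]) _
    _ = Real.exp (L * (-β ^ 2)) := (Real.exp_nat_mul _ _).symm
    _ ≤ Real.exp (Real.log μ) := by
        refine Real.exp_le_exp.2 ?_
        rw [one_div_mul_eq_div, div_le_iff₀ (by positivity), one_div, Real.log_inv] at hL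
        linarith
    _ = μ := Real.exp_log hμ

end Peeling
end StochKernel
end

/-! ### Choice of the constants and assembly. -/

theorem mainTheorem10 (d : ℕ) (hd : 1 ≤ d) :
    ∃ α C₀ : ℝ, 0 < α ∧ α ≤ 1 ∧ 0 < C₀ ∧
      ∀ β : ℝ, 0 < β → β ≤ 1 →
        ∃ K C : ℝ, 0 < K ∧ 0 < C ∧
          ∀ (n : ℕ) (P : StochKernel.ExistentialModel d (Fin n)), (∀ i, β ≤ P.prob i) →
            ∀ ε τ μ : ℝ, 0 < ε → 0 < τ → μ = min ε τ → μ ≤ 1 / 2 →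
              ∀ (δ M : ℝ) (L : ℕ),
                δ = μ * α * β ^ 2 / (4 * (d : ℝ)) →
                M = C₀ * (1 / δ) ^ (((d : ℝ) - 1) / 2) →
                L = ⌈K * Real.log (1 / μ)⌉₊ →
                (∃ S : ℕ → Finset (Fin n), StochKernel.IsPeelingRun P.loc δ M L S) ∧
                ∀ S : ℕ → Finset (Fin n), StochKernel.IsPeelingRun P.loc δ M L S →
                  ((StochKernel.layers S L).card : ℝ) ≤
                      C * ((1 / μ) ^ (((d : ℝ) - 1) / 2) * Real.log (1 / μ)) ∧
                    StochKernel.IsQuantKernel ε τ (P.restrict (StochKernel.layers S L)) P := by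
  obtain ⟨C₀, hC₀, hker⟩ := StochKernel.exists_isKernel d hd
  refine ⟨1, C₀, one_pos, le_rfl, hC₀, fun β hβ hβ1 => ?_⟩
  have hd1 : (1 : ℝ) ≤ d := by exact_mod_cast hd
  have hlog2 : 0 < Real.log 2 := Real.log_pos one_lt_two
  refine ⟨1 / β ^ 2, (1 / β ^ 2 + 1 / Real.log 2) *
    (C₀ * (4 * d / β ^ 2) ^ (((d : ℝ) - 1) / 2)), by positivity, by positivity, ?_⟩
  intro n P hp ε τ μ hε hτ hμ hμ2 δ M L hδ hM hL
  have hμ0 : 0 < μ := hμ ▸ lt_min hε hτ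
  have hμε : μ ≤ ε := hμ ▸ min_le_left _ _
  have hμτ : μ ≤ τ := hμ ▸ min_le_right _ _
  have hδ0 : 0 < δ := by rw [hδ]; positivity
  have hδμ : 4 * δ ≤ μ := by
    have h₁ : μ * β ^ 2 ≤ μ := mul_le_of_le_one_right hμ0.le (by nlinarith)
    have h₂ : δ * d = μ * β ^ 2 / 4 := by rw [hδ]; field_simp
    nlinarith
  have hlog : Real.log 2 ≤ Real.log (1 / μ) :=
    Real.log_le_log two_pos (by rw [le_div_iff₀ hμ0]; linarith)
  have hM0 : 0 ≤ M := by rw [hM]; positivity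
  refine ⟨StochKernel.exists_isPeelingRun (fun A => ?_) L, fun S hS => ⟨?_, fun u x hx => ⟨?_, ?_⟩⟩⟩
  · rw [hM]
    exact hker P.loc δ hδ0 (by linarith) A
  · refine hS.card_layers_le.trans ?_
    -- The `+ 1` from the ceiling is absorbed because `μ ≤ 1 / 2` gives `log (1 / μ) ≥ log 2`.
    have hLle : (L : ℝ) ≤ (1 / β ^ 2 + 1 / Real.log 2) * Real.log (1 / μ) := by
      have h₁ := Nat.ceil_lt_add_one (a := 1 / β ^ 2 * Real.log (1 / μ))
        (mul_nonneg (by positivity) (hlog2.le.trans hlog))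
      rw [← hL] at h₁
      have h₂ : 1 ≤ 1 / Real.log 2 * Real.log (1 / μ) := by
        rwa [one_div_mul_eq_div, one_le_div hlog2]
      linarith
    have hδinv : 1 / δ = 4 * d / β ^ 2 * (1 / μ) := by
      rw [hδ]; field_simp
    calc (L : ℝ) * M ≤ (1 / β ^ 2 + 1 / Real.log 2) * Real.log (1 / μ) * M := by gcongr
      _ = _ := by
        rw [hM, hδinv, Real.mul_rpow (by positivity) (by positivity)]
        ring
  · have h₁ := P.widthCDF_mono u (show (1 - ε) * x ≤ x by nlinarith)
    have h₂ := StochKernel.widthCDF_le_widthCDF_restrict P (StochKernel.layers S L) u x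
    linarith
  · have h₁ := hS.widthCDF_restrict_le hβ.le hp hδ0.le hδμ hμ2
      (StochKernel.one_sub_sq_pow_le hβ hβ1 hμ0 (hL ▸ Nat.le_ceil _)) u hx
    have h₂ := P.widthCDF_mono u (show (1 + μ) * x ≤ (1 + ε) * x by gcongr)
    linarith
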